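/- **Setting.** Let $A:\mathbb N\times\mathbb N\to\{0,1\}$, let $\Sigma=\Sigma_A(\mathbb N)=\{x\in\mathbb N^{\mathbb N}: A(x_i,x_{i+1})=1\ \forall i\ge 0\}$ with the shift map $\sigma$ and the metric $d(x,y)=r^{t(x,y)}$, where $r\in(0,1)$ is fixed and $t(x,y)$ is the first index at which $x$ and $y$ differ ($d(x,x)=0$). A symbol $a$ is admissible if $x_0=a$ for some $x\in\Sigma$. Assume that $\Sigma$ is finitely primitive: there are $K_0\in\mathbb N$ and a finite set $\mathbb F\subset\mathbb N$ such that for all admissible $a,b$ there are $i_1,\dots,i_{K_0}\in\mathbb F$ for which all consecutive transitions of the word $a\,i_1\cdots i_{K_0}\,b$ are allowed by $A$. For $g:\Sigma\to\mathbb R$ put $S_ng=\sum_{j=0}^{n-1}g\circ\sigma^j$ and $\operatorname{Var}_n g=\sup\{|g(x)-g(y)|: x_i=y_i,\ 0\le i<n\}$. Let $f:\Sigma\to\mathbb R$ satisfy * the Walters condition: $\sup_{n\ge1}\operatorname{Var}_{n+k}S_nf<\infty$ for every $k\ge1$, and $\lim_{k\to\infty}\sup_{n\ge1}\operatorname{Var}_{n+k}S_nf=0$;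 * $\operatorname{Var}_1 f<\infty$; * finite Gurevich pressure: for some admissible symbol $a$, $\ P(f)=\lim_{n\to\infty}\frac1n\log\sum_{\sigma^n x=x,\ x_0=a}e^{S_nf(x)}<\infty$ (under the preceding assumptions the limit exists in $(-\infty,\infty]$ and does not depend on $a$). Let $m(f)=\sup_\nu\int f\,d\nu$, the supremum over all $\sigma$-invariant Borel probability measures $\nu$ on $\Sigma$ (integrals in $[-\infty,\infty)$). Such a measure is maximizing if it attains the supremum. A bounded calibrated sub-action is a bounded continuous $V:\Sigma\to\mathbb R$ with $f+V-V\circ\sigma-m(f)\le0$ on $\Sigma$ such that every $y\in\Sigma$ has a preimage $x\in\sigma^{-1}(y)$ at which equality holds. For such a $V$ the deviation function is $$I(x)=-\sum_{j=0}^{\infty}\bigl(f+V-V\circ\sigma-m(f)\bigr)(\sigma^j x)\in[0,\infty].$$ The Mañé potential is $$S_f(x,y)=\lim_{\varepsilon\to0^+}\ \sup_{n\ge1}\ \sup_{\substack{z:\ d(x,z)<\varepsilon\\ \sigma^n(z)=y}}S_n(f-m(f))(z)\in[-\infty,\infty],$$ and the Aubry set is $\Omega(f,\sigma)=\{x\in\Sigma:S_f(x,x)=0\}$.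 **Proposition.** If $f$ has a unique maximizing measure, then $f$ has a bounded calibrated sub-action, and for every bounded calibrated sub-action $V$, with $I$ the deviation function defined by $V$, $$\Omega(f,\sigma)=\{x\in\Sigma: I(x)=0\}.$$ -/

import Mathlib

open Filter Topology MeasureTheory
open scoped ENNReal

namespace CMS

/-- The (one-sided) countable Markov shift `Σ_A(ℕ)` over the alphabet `ℕ`. The `0`-`1` matrix `A` is
given as a relation: `A i j` means that the entry `(i, j)` equals `1`. As a subtype of `ℕ → ℕ` it
carries the product topology and its Borel (product) `σ`-algebra. -/
abbrev Shift (A : ℕ → ℕ → Prop) : Type :=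
  {x : ℕ → ℕ // ∀ i, A (x i) (x (i + 1))}

variable {A : ℕ → ℕ → Prop}

/-- The shift map `σ (x₀, x₁, x₂, …) = (x₁, x₂, …)`. -/
def shift (x : Shift A) : Shift A :=
  ⟨fun i => x.1 (i + 1), fun i => x.2 (i + 1)⟩

/-- The distance `d(x, y) = r ^ t(x, y)`, where `t(x, y)` is the first index at which `x` and `y`
differ (`t(x, x) = ∞` and `d(x, x) = 0`). -/
noncomputable def shiftDist (r : ℝ) (x y : Shift A) : ℝ :=
  open Classical in if x = y then 0 else r ^ PiNat.firstDiff x.1 y.1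

/-- A symbol `a` is admissible if the cylinder `[a]` is non-empty. -/
def Admissible (A : ℕ → ℕ → Prop) (a : ℕ) : Prop :=
  ∃ x : Shift A, x.1 0 = a

/-- `Σ_A(ℕ)` is finitely primitive: there are `K₀` and a finite set `F` of symbols such that any two
admissible symbols `a`, `b` are connected by a word `w` of `K₀` symbols of `F`, that is, all
consecutive transitions of `a w b` are allowed by `A`. -/
def FinitelyPrimitive (A : ℕ → ℕ → Prop) : Prop :=
  ∃ (K : ℕ) (F : Finset ℕ), ∀ a b : ℕ, Admissible A a → Admissible A b →
    ∃ w : List ℕ, w.length = K ∧ (∀ i ∈ w, i ∈ F) ∧ List.IsChain A (a :: (w ++ [b]))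

/-- The `n`-th variation `Var_n g = sup {|g x - g y| : x₀ = y₀, …, x_{n-1} = y_{n-1}}`. -/
noncomputable def variation (n : ℕ) (g : Shift A → ℝ) : ℝ≥0∞ :=
  ⨆ (x : Shift A) (y : Shift A) (_ : ∀ i < n, x.1 i = y.1 i), ENNReal.ofReal |g x - g y|

/-- The Walters condition, with `S_n f = ∑_{j < n} f ∘ σ^j`. -/
def Walters (f : Shift A → ℝ) : Prop :=
  (∀ k ≥ 1, ⨆ n ≥ 1, variation (n + k) (birkhoffSum shift f n) < ⊤) ∧
    Tendsto (fun k : ℕ => ⨆ n ≥ 1, variation (n + k) (birkhoffSum shift f n)) atTop (𝓝 0)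

/-- The partition sum `∑_{σ^n x = x, x₀ = a} exp (S_n f x)`. -/
noncomputable def partitionSum (f : Shift A → ℝ) (a n : ℕ) : ℝ≥0∞ :=
  ∑' x : {x : Shift A // shift^[n] x = x ∧ x.1 0 = a},
    ENNReal.ofReal (Real.exp (birkhoffSum shift f n x.1))

/-- The Gurevich pressure of `f` computed at the symbol `a`, in `[-∞, ∞]`. On a topologically mixing
shift and for a Walters potential the upper limit is a limit that is the same for all admissible
symbols `a`. -/
noncomputable def gurevichPressure (f : Shift A → ℝ) (a : ℕ) : EReal :=
  limsup (fun n : ℕ => ENNReal.log (partitionSum f a n) / (n : EReal)) atTop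

/-- The set of shift-invariant Borel probability measures. -/
def invariantMeasures (A : ℕ → ℕ → Prop) : Set (Measure (Shift A)) :=
  {ν | IsProbabilityMeasure ν ∧ MeasurePreserving (shift (A := A)) ν ν}

/-- The integral of `f` as an extended real number, `∫ f⁺ - ∫ f⁻`; it is `-∞` for a function bounded
above whose negative part is not integrable. -/
noncomputable def extIntegral (f : Shift A → ℝ) (ν : Measure (Shift A)) : EReal :=
  ((∫⁻ x, ENNReal.ofReal (f x) ∂ν : ℝ≥0∞) : EReal) -
    ((∫⁻ x, ENNReal.ofReal (-f x) ∂ν : ℝ≥0∞) : EReal)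

/-- The supremum of `∫ f dν` over all invariant probabilities, in `[-∞, ∞]`. -/
noncomputable def supIntegral (f : Shift A → ℝ) : EReal :=
  ⨆ ν ∈ invariantMeasures A, extIntegral f ν

/-- `μ` is a maximizing measure of `f`. -/
def IsMaximizing (f : Shift A → ℝ) (μ : Measure (Shift A)) : Prop :=
  μ ∈ invariantMeasures A ∧ extIntegral f μ = supIntegral f

/-- The real number `m(f) = sup_ν ∫ f dν`. (For a potential bounded above on a shift with a periodic
point, the supremum is finite.) -/
noncomputable def maxIntegral (f : Shift A → ℝ) : ℝ :=
  (supIntegral f).toReal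

/-- `V` is a bounded calibrated sub-action of `f`: `V` is bounded and continuous,
`f + V - V ∘ σ - m(f) ≤ 0`, and every `y` has a preimage under `σ` at which equality holds. -/
structure IsBoundedCalibratedSubaction (f V : Shift A → ℝ) : Prop where
  continuous : Continuous V
  bounded : ∃ C : ℝ, ∀ x, |V x| ≤ C
  subaction : ∀ x, f x + V x - V (shift x) - maxIntegral f ≤ 0
  calibrated : ∀ y, ∃ x, shift x = y ∧ f x + V x - V (shift x) - maxIntegral f = 0

/-- `sup_{n ≥ 1} sup {S_n (f - m(f)) z : d(x, z) < ε, σ^n z = y}`, in `[-∞, ∞]`. -/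
noncomputable def manePre (r : ℝ) (f : Shift A → ℝ) (x y : Shift A) (ε : ℝ) : EReal :=
  ⨆ (n : ℕ) (_ : 1 ≤ n) (z : Shift A) (_ : shiftDist r x z < ε ∧ shift^[n] z = y),
    ((birkhoffSum shift (fun u => f u - maxIntegral f) n z : ℝ) : EReal)

theorem manePre_mono (r : ℝ) (f : Shift A → ℝ) (x y : Shift A) :
    Monotone (manePre r f x y) := by
  intro ε δ h
  refine iSup_mono fun n => iSup_mono fun _ => iSup_mono fun z => ?_
  exact iSup_mono' fun hz => ⟨⟨hz.1.trans_le h, hz.2⟩, le_rfl⟩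

/-- The Mañé potential `S_f(x, y)`: the limit of `manePre r f x y ε` as `ε` decreases to `0`, which
is an infimum, since `manePre` is monotone in `ε`; see `tendsto_manePre`. -/
noncomputable def manePotential (r : ℝ) (f : Shift A → ℝ) (x y : Shift A) : EReal :=
  ⨅ (ε : ℝ) (_ : 0 < ε), manePre r f x y ε

theorem tendsto_manePre (r : ℝ) (f : Shift A → ℝ) (x y : Shift A) :
    Tendsto (manePre r f x y) (𝓝[>] 0) (𝓝 (manePotential r f x y)) := by
  have h := (manePre_mono r f x y).tendsto_nhdsGT 0
  rwa [sInf_image] at h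

/-- The Aubry set `Ω(f, σ) = {x : S_f(x, x) = 0}`. -/
def aubrySet (r : ℝ) (f : Shift A → ℝ) : Set (Shift A) :=
  {x | manePotential r f x x = 0}

/-- The deviation function `I(x) = ∑_{j ≥ 0} R(σ^j x) ∈ [0, ∞]`, where
`R = -(f + V - V ∘ σ - m(f))`, which is non-negative when `V` is a sub-action. -/
noncomputable def deviation (f V : Shift A → ℝ) (x : Shift A) : ℝ≥0∞ :=
  ∑' j : ℕ, ENNReal.ofReal
    (-(f (shift^[j] x) + V (shift^[j] x) - V (shift (shift^[j] x)) - maxIntegral f))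

end CMS

/-!
Write `m = m(f)` and `R = -(f + V - V ∘ σ - m) ≥ 0` for the defect of a sub-action `V`, so that
`S_n (f - m) z = V (σ^n z) - V z - S_n R z`.

*Existence of a sub-action.* The Walters condition and `Var₁ f < ∞` bound the distortion of `S_n f`
on words of length `n`. With finite primitivity, finite pressure then forces `f → -∞` along the
symbols (`finite_setOf_le_of_gurevichPressure_lt_top`); in particular `f` is bounded above and `m` is
finite. Closing words up to periodic orbits bounds `S_n (f - m)` above, and connecting words of
large weight to a given point bounds `sup {S_n (f - m) z : σ^n z = y}` below, uniformly in `n` and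
`y`. Hence `V y = limsup_n sup {S_n (f - m) z : σ^n z = y}` is bounded; it is continuous by the
Walters condition, and it is a fixed point of the Lax–Oleinik operator, where the maximum over the
preimages is attained because only finitely many symbols compete
(`exists_lax_oleinik_fixedPoint`).

*The Aubry set.* Since `V` is continuous, `x` lies in the Aubry set exactly if there are `z → x` and
`n ≥ 1` with `σ^n z = x` and `S_n R z → 0`. This forces `R x = 0`, and it passes from `x` to `σ x`;
so `R` vanishes along the orbit of `x`, that is, `I x = 0`
(`IsBoundedCalibratedSubaction.defect_eq_zero_of_mem_aubrySet`).

Conversely let `R` vanish along the orbit of `x`. By calibration `x` has a backward orbit on which `R`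
vanishes as well. Where `R = 0`, `f` is bounded below, so both orbits use finitely many symbols and
have non-empty compact limit sets, which are invariant and on which `R = 0`. By the
Krylov–Bogoliubov theorem each limit set carries an invariant probability, which is maximizing
because `R = 0` on it. These measures agree by uniqueness, so the limit sets share a point. Following
`x` until it is close to that point and then switching to the backward orbit of `x` gives almost
closed orbits of almost zero weight
(`IsBoundedCalibratedSubaction.mem_aubrySet_of_defect_eq_zero`).
-/

namespace CMS

/-! ### Invariant measures of continuous maps -/

section Dynamics

variable {X : Type*} [MeasurableSpace X]

/-- The uniform probability measure on the orbit segment `x, T x, …, T^[n-1] x`, counted with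
multiplicity; it is a probability measure for `n ≠ 0`. -/
noncomputable def orbitMeasure (T : X → X) (n : ℕ) (x : X) : Measure X :=
  (n : ℝ≥0∞)⁻¹ • ∑ j ∈ Finset.range n, Measure.dirac (T^[j] x)

theorem isProbabilityMeasure_orbitMeasure (T : X → X) {n : ℕ} (hn : n ≠ 0) (x : X) :
    IsProbabilityMeasure (orbitMeasure T n x) := by
  refine ⟨?_⟩
  simp only [orbitMeasure, Measure.smul_apply, Measure.coe_finsetSum, Finset.sum_apply,
    measure_univ, Finset.sum_const, Finset.card_range, smul_eq_mul, nsmul_eq_mul, mul_one]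
  exact ENNReal.inv_mul_cancel (by exact_mod_cast hn) (ENNReal.natCast_ne_top n)

theorem integral_orbitMeasure (T : X → X) (n : ℕ) (x : X) {g : X → ℝ} (hg : StronglyMeasurable g) :
    ∫ y, g y ∂(orbitMeasure T n x) = (n : ℝ)⁻¹ * birkhoffSum T g n x := by
  rw [orbitMeasure, integral_smul_measure, integral_finsetSum_measure]
  · simp [integral_dirac' _ _ hg, birkhoffSum]
  · intro i _
    exact integrable_dirac' hg (by simp)

theorem integrable_orbitMeasure (T : X → X) {n : ℕ} (hn : n ≠ 0) (x : X) {g : X → ℝ}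
    (hg : StronglyMeasurable g) : Integrable g (orbitMeasure T n x) := by
  refine Integrable.smul_measure ?_ (by simpa using hn)
  exact integrable_finsetSum_measure.2 fun i _ => integrable_dirac' hg (by simp)

theorem measurePreserving_orbitMeasure {T : X → X} (hT : Measurable T) {n : ℕ} {x : X}
    (hx : T^[n] x = x) : MeasurePreserving T (orbitMeasure T n x) (orbitMeasure T n x) := by
  refine ⟨hT, ?_⟩
  have h : ∑ j ∈ Finset.range n, Measure.dirac (T^[j + 1] x)
      = ∑ j ∈ Finset.range n, Measure.dirac (T^[j] x) := by
    cases n with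
    | zero => simp
    | succ n =>
      rw [Finset.sum_range_succ, hx, Finset.sum_range_succ' (fun j => Measure.dirac (T^[j] x))]
      rfl
  rw [orbitMeasure, Measure.map_smul, Measure.map_finset_sum hT.aemeasurable, ← h]
  simp [Measure.map_dirac' hT, Function.iterate_succ_apply']

variable [TopologicalSpace X] [BorelSpace X] [HasOuterApproxClosed X]

/-- The Krylov–Bogoliubov theorem: any limit point of the orbit measures is invariant. -/
theorem exists_invariant_probability [CompactSpace X] [T2Space X] [Nonempty X]
    {T : X → X} (hT : Continuous T) :
    ∃ ν : Measure X, IsProbabilityMeasure ν ∧ MeasurePreserving T ν ν := by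
  obtain ⟨x⟩ := ‹Nonempty X›
  let P : ℕ → ProbabilityMeasure X := fun n =>
    ⟨orbitMeasure T (n + 1) x, isProbabilityMeasure_orbitMeasure T n.succ_ne_zero x⟩
  let U : Ultrafilter ℕ := hyperfilter ℕ
  obtain ⟨μ, -, hμ⟩ := isCompact_univ.ultrafilter_le_nhds (U.map P) (by simp)
  have hP : Tendsto P U (𝓝 μ) := hμ
  have hU : (U : Filter ℕ) ≤ atTop := by
    rw [← Nat.cofinite_eq_atTop]; exact hyperfilter_le_cofinite
  refine ⟨μ, inferInstance, hT.measurable, ?_⟩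
  have : IsProbabilityMeasure (Measure.map T (μ : Measure X)) :=
    Measure.isProbabilityMeasure_map hT.aemeasurable
  refine ext_of_forall_integral_eq_of_IsFiniteMeasure fun g => ?_
  rw [integral_map hT.aemeasurable g.continuous.aestronglyMeasurable]
  rw [ProbabilityMeasure.tendsto_iff_forall_integral_tendsto] at hP
  have h1 := hP g
  have h2 := hP (g.compContinuous ⟨T, hT⟩)
  refine sub_eq_zero.1 (tendsto_nhds_unique (h2.sub h1) (Tendsto.mono_left ?_ hU))
  have key : ∀ n : ℕ, ∫ y, (g.compContinuous ⟨T, hT⟩) y ∂(P n : Measure X) -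
      ∫ y, g y ∂(P n : Measure X) = ((n + 1 : ℕ) : ℝ)⁻¹ * (g (T^[n + 1] x) - g x) := by
    intro n
    have e1 := integral_orbitMeasure T (n + 1) x
      (g.compContinuous ⟨T, hT⟩).continuous.stronglyMeasurable
    have e2 := integral_orbitMeasure T (n + 1) x g.continuous.stronglyMeasurable
    have e3 := birkhoffSum_apply_sub_birkhoffSum T g (n + 1) x
    change ∫ y, (g.compContinuous ⟨T, hT⟩) y ∂(orbitMeasure T (n + 1) x) -
      ∫ y, g y ∂(orbitMeasure T (n + 1) x) = _
    rw [e1, e2, ← mul_sub, ← e3]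
    congr 2
    simp [birkhoffSum, ← Function.iterate_succ_apply', Function.iterate_succ_apply]
  simp only [key]
  refine squeeze_zero_norm (a := fun n : ℕ => ((n + 1 : ℕ) : ℝ)⁻¹ * (2 * ‖g‖)) (fun n => ?_) ?_
  · rw [norm_mul, norm_inv, Real.norm_natCast]
    gcongr
    calc ‖g (T^[n + 1] x) - g x‖ ≤ ‖g (T^[n + 1] x)‖ + ‖g x‖ := norm_sub_le _ _
      _ ≤ 2 * ‖g‖ := by
        linarith [g.norm_coe_le_norm (T^[n + 1] x), g.norm_coe_le_norm x]
  · have := ((tendsto_inv_atTop_nhds_zero_nat (𝕜 := ℝ)).comp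
      (tendsto_add_atTop_nat 1)).mul_const (2 * ‖g‖)
    simpa using this

end Dynamics

/-! ### Compact invariant sets and limit sets of orbits -/

section Invariant

variable {X : Type*} [TopologicalSpace X]

theorem exists_invariant_probability_of_isCompact [MeasurableSpace X] [BorelSpace X]
    [TopologicalSpace.PseudoMetrizableSpace X] [T2Space X]
    {T : X → X} (hT : Continuous T) {E : Set X} (hE : IsCompact E) (hne : E.Nonempty)
    (hinv : Set.MapsTo T E E) :
    ∃ ν : Measure X, IsProbabilityMeasure ν ∧ MeasurePreserving T ν ν ∧ ∀ᵐ x ∂ν, x ∈ E := by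
  have : CompactSpace E := isCompact_iff_compactSpace.1 hE
  have : Nonempty E := hne.to_subtype
  let : PseudoMetricSpace E := TopologicalSpace.pseudoMetrizableSpacePseudoMetric E
  have hr : Continuous (hinv.restrict T E E) := hT.restrict hinv
  obtain ⟨ν, hν, hp⟩ := exists_invariant_probability hr
  have hm : Measurable ((↑) : E → X) := measurable_subtype_coe
  refine ⟨ν.map (↑), Measure.isProbabilityMeasure_map hm.aemeasurable, ⟨hT.measurable, ?_⟩, ?_⟩
  · rw [Measure.map_map hT.measurable hm]
    conv_rhs => rw [← hp.map_eq, Measure.map_map hm hr.measurable]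
    rfl
  · exact (ae_map_iff hm.aemeasurable hE.isClosed.measurableSet).2
      (Eventually.of_forall fun x => x.2)

/-- Limit points of a sequence do not change under a shift of the index. Hence the limit sets of
forward orbits and of backward orbits are invariant. -/
theorem mapClusterPt_add_one_iff {u : ℕ → X} {p : X} :
    MapClusterPt p atTop (fun n => u (n + 1)) ↔ MapClusterPt p atTop u := by
  have : map (fun n => u (n + 1)) atTop = map u atTop := by
    conv_rhs => rw [← map_add_atTop_eq_nat 1, map_map]
    rfl
  rw [MapClusterPt, this, MapClusterPt]

theorem isClosed_setOf_mapClusterPt (u : ℕ → X) : IsClosed {p | MapClusterPt p atTop u} :=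
  isClosed_setOfPred_clusterPt

end Invariant

/-! ### Connecting words -/

section Words

variable {A : ℕ → ℕ → Prop}

theorem shift_iterate_apply (x : Shift A) (n i : ℕ) : (shift^[n] x).1 i = x.1 (i + n) := by
  induction n generalizing i with
  | zero => rfl
  | succ n ih => rw [Function.iterate_succ_apply', shift, ih, add_right_comm, add_assoc]

theorem continuous_shift : Continuous (shift (A := A)) := by
  refine Continuous.subtype_mk (continuous_pi fun i => ?_) _
  exact (continuous_apply (i + 1)).comp continuous_subtype_val

/-- An allowed word of length `N` can be put in front of a point if the last transition is
allowed. -/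
theorem exists_append (v : ℕ → ℕ) (N : ℕ) (y : Shift A)
    (hv : ∀ i, i + 1 < N → A (v i) (v (i + 1))) (hl : ∀ i, i + 1 = N → A (v i) (y.1 0)) :
    ∃ z : Shift A, (∀ i < N, z.1 i = v i) ∧ shift^[N] z = y := by
  refine ⟨⟨fun i => if i < N then v i else y.1 (i - N), fun i => ?_⟩, fun i hi => if_pos hi, ?_⟩
  · rcases lt_trichotomy (i + 1) N with h | h | h
    · simpa [h, (Nat.lt_succ_self i).trans h] using hv i h
    · simpa [h, show i < N by omega] using hl i h
    · have e : i + 1 - N = i - N + 1 := by omega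
      simpa [show ¬ i + 1 < N by omega, show ¬ i < N by omega, e] using y.2 (i - N)
  · ext i
    simp [shift_iterate_apply]

/-- The point `u₀ … u_{n-1} y` for `u_n = y₀`. -/
theorem exists_glue (u y : Shift A) (n : ℕ) (h : u.1 n = y.1 0) :
    ∃ z : Shift A, (∀ i < n, z.1 i = u.1 i) ∧ shift^[n] z = y :=
  exists_append u.1 n y (fun i _ => u.2 i) fun i hi => by
    have := u.2 i
    rwa [hi, h] at this

/-- An allowed word that may follow itself is repeated periodically. -/
theorem exists_periodic (v : ℕ → ℕ) {N : ℕ} (hN : 0 < N)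
    (hv : ∀ i, i + 1 < N → A (v i) (v (i + 1))) (hl : ∀ i, i + 1 = N → A (v i) (v 0)) :
    ∃ p : Shift A, (∀ i < N, p.1 i = v i) ∧ shift^[N] p = p := by
  refine ⟨⟨fun i => v (i % N), fun i => ?_⟩, fun i hi => ?_, ?_⟩
  · have hlt := Nat.mod_lt i hN
    rcases (Nat.succ_le_of_lt hlt).lt_or_eq with h | h
    · have e : (i + 1) % N = i % N + 1 := by
        rw [Nat.add_mod, Nat.mod_eq_of_lt (a := 1) (by omega), Nat.mod_eq_of_lt h]
      simpa only [e] using hv _ h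
    · have e : (i + 1) % N = 0 := by
        rw [← Nat.mod_add_mod, show i % N + 1 = N from h, Nat.mod_self]
      simpa only [e] using hl _ h
  · simp [Nat.mod_eq_of_lt hi]
  · ext i
    simp [shift_iterate_apply]

/-- Any two admissible symbols `a`, `b` are connected by an allowed word `w₀ w₁ … w_K w_{K+1}` with
`w₀ = a`, `w_{K+1} = b` and `w₁, …, w_K ∈ F`: finite primitivity with the connecting word indexed
by positions. -/
def Connecting (A : ℕ → ℕ → Prop) (K : ℕ) (F : Finset ℕ) : Prop :=
  ∀ a b : ℕ, Admissible A a → Admissible A b → ∃ w : ℕ → ℕ, w 0 = a ∧ w (K + 1) = b ∧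
    (∀ i ≤ K, A (w i) (w (i + 1))) ∧ ∀ i, 0 < i → i ≤ K → w i ∈ F

theorem FinitelyPrimitive.exists_connecting (hA : FinitelyPrimitive A) :
    ∃ K F, Connecting A K F := by
  obtain ⟨K, F, h⟩ := hA
  refine ⟨K, F, fun a b ha hb => ?_⟩
  obtain ⟨w, rfl, hF, hc⟩ := h a b ha hb
  rw [List.isChain_iff_getElem] at hc
  refine ⟨fun i => (a :: (w ++ [b])).getD i 0, by simp, by simp, fun i hi => ?_, fun i h0 hi => ?_⟩
  · have := hc i (by simp; omega)
    rwa [← List.getD_eq_getElem _ 0, ← List.getD_eq_getElem _ 0] at this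
  · obtain ⟨j, rfl⟩ : ∃ j, i = j + 1 := ⟨i - 1, by omega⟩
    refine hF _ ?_
    simp only [List.getD_cons_succ]
    rw [List.getD_append _ _ _ _ (by omega), List.getD_eq_getElem _ _ (by omega)]
    exact List.getElem_mem _

theorem admissible_apply (x : Shift A) (n : ℕ) : Admissible A (x.1 n) :=
  ⟨shift^[n] x, by rw [shift_iterate_apply, zero_add]⟩

variable {K : ℕ} {F : Finset ℕ}

/-- A point `u₀ … u_n w₁ … w_K y₀ y₁ …` with `w₁, …, w_K ∈ F`. -/
theorem Connecting.exists_connect (hA : Connecting A K F) (u y : Shift A) (n : ℕ) :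
    ∃ z : Shift A, (∀ i ≤ n, z.1 i = u.1 i) ∧ (∀ i, n < i → i ≤ n + K → z.1 i ∈ F) ∧
      shift^[n + 1 + K] z = y := by
  obtain ⟨w, h0, h1, hw, hF⟩ := hA _ _ (admissible_apply u n) (admissible_apply y 0)
  have hv : ∀ i, i + 1 < n + 1 + K → A (if i ≤ n then u.1 i else w (i - n))
      (if i + 1 ≤ n then u.1 (i + 1) else w (i + 1 - n)) := by
    intro i hi
    rcases lt_trichotomy i n with h | rfl | h
    · simpa [h, h.le] using u.2 i
    · simpa [h0] using hw 0 (by omega)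
    · simpa [show ¬ i ≤ n by omega, show ¬ i + 1 ≤ n by omega, show i + 1 - n = i - n + 1 by omega]
        using hw (i - n) (by omega)
  have hl : ∀ i, i + 1 = n + 1 + K → A (if i ≤ n then u.1 i else w (i - n)) (y.1 0) := by
    intro i hi
    have hK := hw K le_rfl
    rw [h1] at hK
    obtain rfl : i = n + K := by omega
    rcases Nat.eq_zero_or_pos K with rfl | h
    · simpa [h0] using hK
    · simpa [show ¬ K = 0 by omega] using hK
  obtain ⟨z, hz, hs⟩ := exists_append _ (n + 1 + K) y hv hl
  refine ⟨z, fun i hi => ?_, fun i hi hi' => ?_, hs⟩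
  · rw [hz i (by omega), if_pos hi]
  · rw [hz i (by omega), if_neg (by omega)]
    exact hF _ (by omega) (by omega)

/-- A periodic point `u₀ … u_n w₁ … w_K u₀ …` with `w₁, …, w_K ∈ F`. -/
theorem Connecting.exists_close (hA : Connecting A K F) (u : Shift A) (n : ℕ) :
    ∃ p : Shift A, (∀ i ≤ n, p.1 i = u.1 i) ∧ (∀ i, n < i → i ≤ n + K → p.1 i ∈ F) ∧
      shift^[n + 1 + K] p = p := by
  obtain ⟨z, hz, hzF, hs⟩ := hA.exists_connect u u n
  have hl : ∀ i, i + 1 = n + 1 + K → A (z.1 i) (z.1 0) := by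
    intro i hi
    have h := z.2 i
    rw [hi] at h
    have e := shift_iterate_apply z (n + 1 + K) 0
    rw [hs, zero_add] at e
    rwa [hz 0 (Nat.zero_le n), e]
  obtain ⟨p, hp, hs'⟩ := exists_periodic z.1 (by omega) (fun i _ => z.2 i) hl
  refine ⟨p, fun i hi => ?_, fun i hi hi' => ?_, hs'⟩
  · rw [hp i (by omega), hz i hi]
  · rw [hp i (by omega)]
    exact hzF i hi hi'

end Words

/-! ### Topology of the shift -/

section Metric

variable {A : ℕ → ℕ → Prop}

theorem hasBasis_nhds (x : Shift A) :
    (𝓝 x).HasBasis (fun _ : ℕ => True) fun n => {z | ∀ i < n, x.1 i = z.1 i} := by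
  refine ⟨fun s => ⟨fun hs => ?_, fun ⟨n, _, hn⟩ => ?_⟩⟩
  · rw [show 𝓝 x = comap Subtype.val (𝓝 x.1) from nhds_induced _ _, mem_comap] at hs
    obtain ⟨t, ht, hts⟩ := hs
    obtain ⟨_, ⟨⟨y, n, rfl⟩, hy, hyt⟩⟩ :=
      (PiNat.isTopologicalBasis_cylinders (fun _ : ℕ => ℕ)).mem_nhds_iff.1 ht
    refine ⟨n, trivial, fun z hz => hts (hyt fun i hi => ?_)⟩
    exact (hz i hi).symm.trans (hy i hi)
  · refine mem_of_superset ?_ hn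
    have hc : ∀ i < n, {z : Shift A | x.1 i = z.1 i} ∈ 𝓝 x := fun i _ => by
      have : Continuous fun z : Shift A => z.1 i :=
        (continuous_apply i).comp continuous_subtype_val
      exact this.continuousAt.preimage_mem_nhds (t := {j | x.1 i = j})
        ((isOpen_discrete _).mem_nhds rfl)
    have := (biInter_mem (Set.finite_lt_nat n)).2 hc
    filter_upwards [this] with z hz i hi
    simpa using Set.mem_iInter₂.1 hz i hi

theorem exists_shiftDist_lt {r : ℝ} (hr0 : 0 < r) (hr1 : r < 1) {ε : ℝ} (hε : 0 < ε) :
    ∃ n : ℕ, ∀ x z : Shift A, (∀ i < n, x.1 i = z.1 i) → shiftDist r x z < ε := by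
  obtain ⟨n, hn⟩ := exists_pow_lt_of_lt_one hε hr1
  refine ⟨n, fun x z h => ?_⟩
  rw [shiftDist]
  split_ifs with hxz
  · exact hε
  · refine lt_of_le_of_lt (pow_le_pow_of_le_one hr0.le hr1.le ?_) hn
    rw [← PiNat.mem_cylinder_iff_le_firstDiff fun e => hxz (Subtype.ext e)]
    exact fun i hi => h i hi

theorem eq_of_shiftDist_lt {r : ℝ} (hr0 : 0 < r) (hr1 : r < 1) {n : ℕ} {x z : Shift A}
    (h : shiftDist r x z < r ^ n) {i : ℕ} (hi : i < n) : x.1 i = z.1 i := by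
  rw [shiftDist] at h
  split_ifs at h with hxz
  · rw [hxz]
  · exact PiNat.apply_eq_of_lt_firstDiff (hi.trans ((pow_lt_pow_iff_right_of_lt_one₀ hr0 hr1).1 h))

theorem isCompact_setOf_forall_mem (F : Finset ℕ) : IsCompact {x : Shift A | ∀ i, x.1 i ∈ F} := by
  have hcl : IsClosed {x : ℕ → ℕ | ∀ i, A (x i) (x (i + 1))} := by
    simp only [Set.ofPred_forall]
    refine isClosed_iInter fun i => ?_
    have hc : Continuous fun x : ℕ → ℕ => (x i, x (i + 1)) :=
      (continuous_apply i).prodMk (continuous_apply (i + 1))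
    exact (isClosed_discrete {p : ℕ × ℕ | A p.1 p.2}).preimage hc
  have he : IsClosedEmbedding (Subtype.val : Shift A → ℕ → ℕ) :=
    ⟨IsEmbedding.subtypeVal, by rwa [Subtype.range_val_subtype]⟩
  have h := he.isCompact_preimage
    (isCompact_univ_pi (s := fun _ : ℕ => (F : Set ℕ)) fun _ => F.finite_toSet.isCompact)
  convert h using 1
  refine Set.ext fun x => ?_
  simp

end Metric

/-! ### Walters potentials of finite pressure -/

section Potential

variable {A : ℕ → ℕ → Prop} {f : Shift A → ℝ}

theorem abs_sub_le_of_variation_le {n : ℕ} {g : Shift A → ℝ} {c : ℝ≥0∞} (hc : c ≠ ⊤)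
    (h : variation n g ≤ c) {x y : Shift A} (hxy : ∀ i < n, x.1 i = y.1 i) :
    |g x - g y| ≤ c.toReal := by
  refine (ENNReal.ofReal_le_iff_le_toReal hc).1 (le_trans ?_ h)
  exact le_iSup_of_le x (le_iSup_of_le y (le_iSup_of_le hxy le_rfl))

/-- For a Walters potential, the distortion of the Birkhoff sums `S_n f` on words of length `n + k`
is small uniformly in `n` when `k` is large. -/
theorem Walters.exists_abs_sub_le (hf : Walters f) {δ : ℝ} (hδ : 0 < δ) :
    ∃ k : ℕ, ∀ (n : ℕ) (x y : Shift A), (∀ i < n + k, x.1 i = y.1 i) →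
      |birkhoffSum shift f n x - birkhoffSum shift f n y| ≤ δ := by
  have hev := hf.2.eventually (ge_mem_nhds (ENNReal.ofReal_pos.2 hδ))
  obtain ⟨k, hk⟩ := hev.exists
  refine ⟨k, fun n x y hxy => ?_⟩
  rcases Nat.eq_zero_or_pos n with rfl | hn
  · simpa using hδ.le
  · have h := abs_sub_le_of_variation_le ENNReal.ofReal_ne_top
      ((le_iSup₂_of_le n hn le_rfl).trans hk) hxy
    rwa [ENNReal.toReal_ofReal hδ.le] at h

/-- The distortion of `S_n f` on words of length `n` is bounded: the last term is controlled by
`Var₁ f` and the first `n - 1` terms by the Walters condition with `k = 1`. -/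
theorem Walters.exists_abs_sub_le_of_variation_one (hf : Walters f) (hf1 : variation 1 f < ⊤) :
    ∃ C : ℝ, ∀ (n : ℕ) (x y : Shift A), (∀ i < n, x.1 i = y.1 i) →
      |birkhoffSum shift f n x - birkhoffSum shift f n y| ≤ C := by
  set W : ℝ≥0∞ := ⨆ n ≥ 1, variation (n + 1) (birkhoffSum shift f n)
  have hW : W < ⊤ := hf.1 1 le_rfl
  refine ⟨W.toReal + (variation 1 f).toReal, fun n x y hxy => ?_⟩
  have hW0 : 0 ≤ W.toReal := ENNReal.toReal_nonneg
  cases n with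
  | zero => simp [add_nonneg hW0 ENNReal.toReal_nonneg]
  | succ n =>
    have h1 : |birkhoffSum shift f n x - birkhoffSum shift f n y| ≤ W.toReal := by
      rcases Nat.eq_zero_or_pos n with rfl | hn
      · simp [hW0]
      · exact abs_sub_le_of_variation_le hW.ne (le_iSup₂_of_le n hn le_rfl) hxy
    have h2 : |f (shift^[n] x) - f (shift^[n] y)| ≤ (variation 1 f).toReal := by
      refine abs_sub_le_of_variation_le hf1.ne le_rfl fun i hi => ?_
      obtain rfl : i = 0 := by omega
      simpa [shift_iterate_apply] using hxy n n.lt_succ_self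
    rw [birkhoffSum_succ, birkhoffSum_succ, add_sub_add_comm]
    exact (abs_add_le _ _).trans (add_le_add h1 h2)

theorem Walters.continuous (hf : Walters f) : Continuous f := by
  refine continuous_iff_continuousAt.2 fun x => Metric.tendsto_nhds.2 fun ε hε => ?_
  obtain ⟨k, hk⟩ := hf.exists_abs_sub_le (half_pos hε)
  filter_upwards [(hasBasis_nhds x).mem_of_mem (i := 1 + k) trivial] with z hz
  have h := hk 1 x z hz
  rw [birkhoffSum_one, birkhoffSum_one] at h
  rw [dist_comm, Real.dist_eq]
  linarith

/-- A function with finite oscillation on `1`-cylinders is bounded on finitely many of them. -/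
theorem exists_abs_le_of_mem {C : ℝ} (hC : ∀ x y : Shift A, x.1 0 = y.1 0 → |f x - f y| ≤ C)
    {G : Set ℕ} (hG : G.Finite) : ∃ B : ℝ, 0 ≤ B ∧ ∀ x : Shift A, x.1 0 ∈ G → |f x| ≤ B := by
  induction G, hG using Set.Finite.induction_on with
  | empty => exact ⟨0, le_rfl, fun x hx => hx.elim⟩
  | @insert b G _ _ ih =>
    obtain ⟨B, hB0, hB⟩ := ih
    by_cases hb : Admissible A b
    · obtain ⟨y, rfl⟩ := hb
      refine ⟨max B (C + |f y|), le_max_of_le_left hB0, fun x hx => ?_⟩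
      rcases hx with hx | hx
      · refine le_max_of_le_right ?_
        have h1 := hC x y hx
        have h2 := abs_add_le (f x - f y) (f y)
        rw [sub_add_cancel] at h2
        linarith
      · exact le_max_of_le_left (hB x hx)
    · refine ⟨B, hB0, fun x hx => ?_⟩
      rcases hx with hx | hx
      · exact absurd ⟨x, hx⟩ hb
      · exact hB x hx

variable {K : ℕ} {F : Finset ℕ}

/-- Finite pressure forces `f` to tend to `-∞` along the symbols. For a suitable period `N`, every
admissible symbol `i` occurs at position `K + 1` of some `N`-periodic point that starts with `a` and
has its other symbols in the finite set `F ∪ {a}`; the sum of `exp (S_N f)` over these points is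
finite. -/
theorem finite_setOf_le_of_gurevichPressure_lt_top (hA : Connecting A K F) {C : ℝ}
    (hC : ∀ x y : Shift A, x.1 0 = y.1 0 → |f x - f y| ≤ C) {a : ℕ} (ha : Admissible A a)
    (hP : gurevichPressure f a < ⊤) (c : ℝ) : {i | ∃ x : Shift A, x.1 0 = i ∧ c ≤ f x}.Finite := by
  obtain ⟨n, hnK, hZ⟩ : ∃ n, K + 1 ≤ n ∧ partitionSum f a (n + 1 + K) ≠ ⊤ := by
    have h := (tendsto_add_atTop_nat (1 + K)).eventually (eventually_lt_of_limsup_lt hP)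
    obtain ⟨n, hn, hn'⟩ := (h.and (eventually_ge_atTop (K + 1))).exists
    refine ⟨n, hn', fun e => ?_⟩
    rw [← add_assoc, e, ENNReal.log_top, EReal.top_div_of_pos_ne_top] at hn
    · exact lt_irrefl _ hn
    · exact_mod_cast (by omega : 0 < n + 1 + K)
    · exact EReal.natCast_ne_top _
  set N := n + 1 + K
  obtain ⟨u, hu⟩ := ha
  set G : Set ℕ := insert a (F : Set ℕ)
  -- `q` has all its symbols in `G`; it fills up the periodic points to the prescribed period.
  obtain ⟨q, hq0, hqF, hq⟩ := hA.exists_close u 0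
  have hqG : ∀ i, q.1 i ∈ G := by
    intro i
    induction i using Nat.strong_induction_on with
    | _ i ih =>
      rcases Nat.lt_or_ge i (0 + 1 + K) with hi | hi
      · rcases Nat.eq_zero_or_pos i with rfl | h0
        · exact Or.inl ((hq0 0 le_rfl).trans hu)
        · exact Or.inr (hqF i h0 (by omega))
      · have e := shift_iterate_apply q (0 + 1 + K) (i - (0 + 1 + K))
        rw [hq, Nat.sub_add_cancel hi] at e
        rw [← e]
        exact ih _ (by omega)
  have key : ∀ i : {i // Admissible A i}, ∃ p : Shift A, shift^[N] p = p ∧ p.1 0 = a ∧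
      p.1 (K + 1) = i ∧ ∀ j < N, j ≠ K + 1 → p.1 j ∈ G := by
    rintro ⟨_, x, rfl⟩
    obtain ⟨z, hz0, hzF, hz⟩ := hA.exists_connect u x 0
    obtain ⟨z', hz0', hzF', hz'⟩ := hA.exists_connect z q (K + 1)
    obtain ⟨p, hp0, hpF, hp⟩ := hA.exists_close z' n
    have hj : ∀ j ≤ K + 1, p.1 j = z.1 j := fun j hj => by rw [hp0 j (by omega), hz0' j hj]
    have hzK : z.1 (K + 1) = x.1 0 := by
      have e := shift_iterate_apply z (0 + 1 + K) 0
      rw [hz] at e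
      rw [e, show K + 1 = 0 + (0 + 1 + K) by omega]
    refine ⟨p, hp, by rw [hj 0 (by omega), hz0 0 le_rfl, hu], by rw [hj _ le_rfl, hzK],
      fun j hjN hjK => ?_⟩
    rcases Nat.lt_or_ge n j with h | h
    · exact Or.inr (hpF j h (by omega))
    rcases Nat.lt_or_ge j (K + 1) with h1 | h1
    · rw [hj j h1.le]
      rcases Nat.eq_zero_or_pos j with rfl | h0
      · exact Or.inl ((hz0 0 le_rfl).trans hu)
      · exact Or.inr (hzF j h0 (by omega))
    rw [hp0 j h]
    rcases Nat.lt_or_ge (K + 1 + K) j with h2 | h2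
    · have e := shift_iterate_apply z' (K + 1 + 1 + K) (j - (K + 1 + 1 + K))
      rw [hz', Nat.sub_add_cancel (by omega)] at e
      rw [← e]
      exact hqG _
    · exact Or.inr (hzF' j (by omega) h2)
  choose p hpN hpa hpi hpG using key
  obtain ⟨B, hB0, hB⟩ := exists_abs_le_of_mem hC (F.finite_toSet.insert a)
  let P : {i // Admissible A i} → {x : Shift A // shift^[N] x = x ∧ x.1 0 = a} :=
    fun i => ⟨p i, hpN i, hpa i⟩
  have hPinj : Function.Injective P := fun i j h => by
    have : p i = p j := congrArg Subtype.val h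
    exact Subtype.ext (by rw [← hpi i, ← hpi j, this])
  have hsum : ∑' i, ENNReal.ofReal (Real.exp (birkhoffSum shift f N (p i))) ≠ ⊤ :=
    ne_top_of_le_ne_top hZ (ENNReal.tsum_comp_le_tsum_of_injective hPinj
      fun x => ENNReal.ofReal (Real.exp (birkhoffSum shift f N x.1)))
  have hfin := ENNReal.finite_const_le_of_tsum_ne_top hsum
    (ε := ENNReal.ofReal (Real.exp (c - C - N * B))) (by simp [Real.exp_pos])
  refine (hfin.image Subtype.val).subset ?_
  rintro _ ⟨x, rfl, hx⟩
  refine ⟨⟨x.1 0, x, rfl⟩, ENNReal.ofReal_le_ofReal (Real.exp_le_exp.2 ?_), rfl⟩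
  set i : {i // Admissible A i} := ⟨x.1 0, x, rfl⟩
  have hKN : K + 1 ∈ Finset.range N := Finset.mem_range.2 (by omega)
  rw [birkhoffSum, ← Finset.add_sum_erase _ _ hKN]
  have h1 : c - C ≤ f (shift^[K + 1] (p i)) := by
    have h := hC x (shift^[K + 1] (p i)) (by rw [shift_iterate_apply, zero_add, hpi])
    linarith [(abs_le.1 h).2]
  have h2 : -(N * B) ≤ ∑ j ∈ (Finset.range N).erase (K + 1), f (shift^[j] (p i)) := by
    have hlow : ∀ j ∈ (Finset.range N).erase (K + 1), -B ≤ f (shift^[j] (p i)) := by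
      intro j hj
      rw [Finset.mem_erase, Finset.mem_range] at hj
      refine (abs_le.1 (hB _ ?_)).1
      rw [shift_iterate_apply, zero_add]
      exact hpG i j hj.2 hj.1
    have h3 := Finset.card_nsmul_le_sum _ _ _ hlow
    have h4 : (((Finset.range N).erase (K + 1)).card : ℝ) ≤ N := by
      exact_mod_cast (Finset.card_le_card (Finset.erase_subset _ _)).trans (Finset.card_range N).le
    rw [nsmul_eq_mul] at h3
    nlinarith
  linarith

/-- A potential that tends to `-∞` along the symbols is bounded above. -/
theorem exists_le_of_finite_setOf_le {C : ℝ}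
    (hC : ∀ x y : Shift A, x.1 0 = y.1 0 → |f x - f y| ≤ C)
    (hfin : ∀ c : ℝ, {i | ∃ x : Shift A, x.1 0 = i ∧ c ≤ f x}.Finite) : ∃ M, ∀ x, f x ≤ M := by
  obtain ⟨B, hB0, hB⟩ := exists_abs_le_of_mem hC (hfin 0)
  refine ⟨B, fun x => ?_⟩
  by_cases hx : 0 ≤ f x
  · exact (le_abs_self _).trans (hB x ⟨x, rfl, hx⟩)
  · linarith

end Potential

/-! ### Maximizing measures -/

section Integral

variable {A : ℕ → ℕ → Prop} {f : Shift A → ℝ} {ν : Measure (Shift A)}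

theorem extIntegral_eq_integral (hf : Integrable f ν) :
    extIntegral f ν = ((∫ x, f x ∂ν : ℝ) : EReal) := by
  have h1 : ∫⁻ x, ENNReal.ofReal (f x) ∂ν ≠ ⊤ := hf.lintegral_lt_top.ne
  have h2 : ∫⁻ x, ENNReal.ofReal (-f x) ∂ν ≠ ⊤ := hf.neg.lintegral_lt_top.ne
  rw [extIntegral, integral_eq_lintegral_pos_part_sub_lintegral_neg_part hf, EReal.coe_sub,
    EReal.coe_ennreal_toReal h1, EReal.coe_ennreal_toReal h2]

theorem lintegral_ofReal_le [IsProbabilityMeasure ν] {M : ℝ} (hM : ∀ x, f x ≤ M) :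
    ∫⁻ x, ENNReal.ofReal (f x) ∂ν ≤ ENNReal.ofReal M :=
  (lintegral_mono fun x => ENNReal.ofReal_le_ofReal (hM x)).trans (by simp)

theorem supIntegral_lt_top {M : ℝ} (hM : ∀ x, f x ≤ M) : supIntegral f < ⊤ := by
  refine lt_of_le_of_lt (iSup₂_le (a := ((ENNReal.ofReal M : ℝ≥0∞) : EReal)) fun ν hν => ?_)
    (lt_top_iff_ne_top.2 (by simp))
  have := hν.1
  refine (EReal.sub_le_sub (EReal.coe_ennreal_le_coe_ennreal_iff.2 (lintegral_ofReal_le hM))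
    (EReal.coe_ennreal_nonneg _)).trans_eq (sub_zero _)

/-- A function bounded above with integral different from `-∞` is integrable. -/
theorem integrable_of_extIntegral_ne_bot [IsProbabilityMeasure ν] (hf : Continuous f) {M : ℝ}
    (hM : ∀ x, f x ≤ M) (h : extIntegral f ν ≠ ⊥) : Integrable f ν := by
  have h1 : ∫⁻ x, ENNReal.ofReal (f x) ∂ν ≠ ⊤ :=
    ne_top_of_le_ne_top ENNReal.ofReal_ne_top (lintegral_ofReal_le hM)
  have h2 : ∫⁻ x, ENNReal.ofReal (-f x) ∂ν ≠ ⊤ := fun e => by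
    rw [extIntegral, e, EReal.coe_ennreal_top, EReal.sub_top] at h
    exact h rfl
  refine ⟨hf.aestronglyMeasurable, ?_⟩
  have e : ∀ x, ‖f x‖ₑ = ENNReal.ofReal (f x) + ENNReal.ofReal (-f x) := fun x => by
    rw [Real.enorm_eq_ofReal_abs]
    rcases le_total 0 (f x) with h | h
    · rw [abs_of_nonneg h, ENNReal.ofReal_of_nonpos (neg_nonpos.2 h), add_zero]
    · rw [abs_of_nonpos h, ENNReal.ofReal_of_nonpos h, zero_add]
  simp only [HasFiniteIntegral, e]
  rw [lintegral_add_left hf.measurable.ennreal_ofReal]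
  exact ENNReal.add_lt_top.2 ⟨h1.lt_top, h2.lt_top⟩

/-- The supremum defining `m(f)` is finite: it is bounded above with `f`, and periodic orbits bound it
below. So `maxIntegral f` is not a junk value of `EReal.toReal`. -/
theorem coe_maxIntegral {K : ℕ} {F : Finset ℕ} (hA : Connecting A K F) (x : Shift A)
    (hf : Continuous f) {M : ℝ} (hM : ∀ x, f x ≤ M) :
    ((maxIntegral f : ℝ) : EReal) = supIntegral f := by
  obtain ⟨p, -, -, hp⟩ := hA.exists_close x 0
  have hn : 0 + 1 + K ≠ 0 := by omega
  have hint := integrable_orbitMeasure shift hn p hf.stronglyMeasurable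
  refine EReal.coe_toReal (supIntegral_lt_top hM).ne fun e => ?_
  have h : extIntegral f (orbitMeasure shift (0 + 1 + K) p) ≤ supIntegral f :=
    le_iSup₂_of_le _ ⟨isProbabilityMeasure_orbitMeasure _ hn _,
      measurePreserving_orbitMeasure continuous_shift.measurable hp⟩ le_rfl
  rw [e, extIntegral_eq_integral hint] at h
  exact EReal.coe_ne_bot _ (le_bot_iff.1 h)

theorem birkhoffSum_le_of_periodic (hm : ((maxIntegral f : ℝ) : EReal) = supIntegral f)
    (hf : Continuous f) {n : ℕ} {p : Shift A} (hp : shift^[n] p = p) :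
    birkhoffSum shift f n p ≤ n * maxIntegral f := by
  rcases Nat.eq_zero_or_pos n with rfl | hn
  · simp
  have hint := integrable_orbitMeasure shift hn.ne' p hf.stronglyMeasurable
  have h : extIntegral f (orbitMeasure shift n p) ≤ supIntegral f :=
    le_iSup₂_of_le _ ⟨isProbabilityMeasure_orbitMeasure _ hn.ne' _,
      measurePreserving_orbitMeasure continuous_shift.measurable hp⟩ le_rfl
  rw [← hm, extIntegral_eq_integral hint, EReal.coe_le_coe_iff,
    integral_orbitMeasure _ _ _ hf.stronglyMeasurable] at h
  rwa [inv_mul_le_iff₀ (by exact_mod_cast hn)] at h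

theorem IsMaximizing.integral_eq (hm : ((maxIntegral f : ℝ) : EReal) = supIntegral f)
    (hf : Continuous f) {M : ℝ} (hM : ∀ x, f x ≤ M)
    (hν : IsMaximizing f ν) : Integrable f ν ∧ ∫ x, f x ∂ν = maxIntegral f := by
  have := hν.1.1
  have e := hν.2
  rw [← hm] at e
  have hi := integrable_of_extIntegral_ne_bot hf hM (by rw [e]; exact EReal.coe_ne_bot _)
  rw [extIntegral_eq_integral hi] at e
  exact ⟨hi, EReal.coe_injective e⟩

/-- Since `S_n f` has integral `n m(f)` against a maximizing measure, it is somewhere at least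
`n m(f)`. -/
theorem exists_le_birkhoffSum (hm : ((maxIntegral f : ℝ) : EReal) = supIntegral f)
    (hf : Continuous f) {M : ℝ} (hM : ∀ x, f x ≤ M)
    (hν : IsMaximizing f ν) (n : ℕ) : ∃ u, n * maxIntegral f ≤ birkhoffSum shift f n u := by
  obtain ⟨hi, he⟩ := hν.integral_eq hm hf hM
  have := hν.1.1
  have hj : ∀ j, Integrable (fun x => f (shift^[j] x)) ν := fun j =>
    ((hν.1.2.iterate j).integrable_comp hi.aestronglyMeasurable).2 hi
  have hS : ∫ x, birkhoffSum shift f n x ∂ν = n * maxIntegral f := by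
    simp only [birkhoffSum]
    rw [integral_finsetSum _ fun j _ => hj j]
    have : ∀ j ∈ Finset.range n, ∫ x, f (shift^[j] x) ∂ν = maxIntegral f := fun j _ => by
      rw [← he]
      conv_rhs => rw [← (hν.1.2.iterate j).map_eq]
      rw [integral_map (hν.1.2.iterate j).measurable.aemeasurable hf.aestronglyMeasurable]
    rw [Finset.sum_congr rfl this]
    simp
  rw [← hS]
  exact exists_integral_le (integrable_finsetSum _ fun j _ => hj j)

end Integral

/-! ### Existence of a calibrated sub-action -/

section Subaction

variable {A : ℕ → ℕ → Prop} {f : Shift A → ℝ} {K : ℕ} {F : Finset ℕ}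

theorem birkhoffSum_sub_const (f : Shift A → ℝ) (m : ℝ) (n : ℕ) (x : Shift A) :
    birkhoffSum shift (fun u => f u - m) n x = birkhoffSum shift f n x - n * m := by
  simp [birkhoffSum, Finset.sum_sub_distrib]

theorem abs_birkhoffSum_le {B : ℝ} {n : ℕ} {x : Shift A}
    (h : ∀ j < n, |f (shift^[j] x)| ≤ B) : |birkhoffSum shift f n x| ≤ n * B := by
  refine (Finset.abs_sum_le_sum_abs _ _).trans ?_
  refine (Finset.sum_le_card_nsmul _ _ B fun j hj => h j (Finset.mem_range.1 hj)).trans ?_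
  simp

/-- The normalized Birkhoff sums `S_n (f - m(f))` are bounded above, since every word can be closed
up to a periodic orbit at a bounded cost. -/
theorem exists_birkhoffSum_sub_maxIntegral_le (hA : Connecting A K F) (hf : Continuous f)
    (hm : ((maxIntegral f : ℝ) : EReal) = supIntegral f) {C : ℝ}
    (hC : ∀ (n : ℕ) (x y : Shift A), (∀ i < n, x.1 i = y.1 i) →
      |birkhoffSum shift f n x - birkhoffSum shift f n y| ≤ C) :
    ∃ D, ∀ n z, birkhoffSum shift (fun u => f u - maxIntegral f) n z ≤ D := by
  obtain ⟨B, hB0, hB⟩ := exists_abs_le_of_mem (f := f) (C := C)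
    (fun x y h => by simpa using hC 1 x y (by simpa using h)) F.finite_toSet
  refine ⟨C + K * B + K * |maxIntegral f|, fun n z => ?_⟩
  have hC0 : 0 ≤ C := by simpa using hC 0 z z (by simp)
  have hm0 := neg_abs_le (maxIntegral f)
  have hm1 := le_abs_self (maxIntegral f)
  rw [birkhoffSum_sub_const]
  cases n with
  | zero =>
    simp only [birkhoffSum_zero, Nat.cast_zero, zero_mul, sub_zero]
    positivity
  | succ n =>
    obtain ⟨p, hp0, hpF, hp⟩ := hA.exists_close z n
    have h1 := birkhoffSum_le_of_periodic hm hf hp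
    rw [birkhoffSum_add] at h1
    have h2 := (abs_le.1 (hC (n + 1) z p fun i hi => (hp0 i (by omega)).symm)).2
    have h3 : |birkhoffSum shift f K (shift^[n + 1] p)| ≤ K * B := by
      refine abs_birkhoffSum_le fun j hj => hB _ ?_
      rw [← Function.iterate_add_apply, shift_iterate_apply]
      exact hpF _ (by omega) (by omega)
    have h4 := (abs_le.1 h3).1
    have h5 : (K : ℝ) * maxIntegral f ≤ K * |maxIntegral f| := by gcongr
    push_cast at h1 ⊢
    linarith

/-- Every point has, for all large `n`, an `n`-th preimage at which `S_n (f - m(f))` is bounded below: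
a word along which the mean of `f` is at least `m(f)`, which exists since `m(f)` is the integral of
`f` against an invariant measure, is connected to the point at a bounded cost. -/
theorem exists_le_birkhoffSum_sub_maxIntegral (hA : Connecting A K F) (hf : Continuous f)
    (hm : ((maxIntegral f : ℝ) : EReal) = supIntegral f) {M : ℝ} (hM : ∀ x, f x ≤ M)
    {μ : Measure (Shift A)} (hμ : IsMaximizing f μ) {C : ℝ}
    (hC : ∀ (n : ℕ) (x y : Shift A), (∀ i < n, x.1 i = y.1 i) →
      |birkhoffSum shift f n x - birkhoffSum shift f n y| ≤ C) :
    ∃ E, ∀ y, ∀ n > K, ∃ z, shift^[n] z = y ∧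
      E ≤ birkhoffSum shift (fun u => f u - maxIntegral f) n z := by
  obtain ⟨B, hB0, hB⟩ := exists_abs_le_of_mem (f := f) (C := C)
    (fun x y h => by simpa using hC 1 x y (by simpa using h)) F.finite_toSet
  refine ⟨-(C + K * B + K * |maxIntegral f|), fun y n hn => ?_⟩
  obtain ⟨n, rfl⟩ : ∃ k, n = k + 1 + K := ⟨n - K - 1, by omega⟩
  obtain ⟨u, hu⟩ := exists_le_birkhoffSum hm hf hM hμ (n + 1)
  obtain ⟨z, hz0, hzF, hz⟩ := hA.exists_connect u y n
  refine ⟨z, hz, ?_⟩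
  rw [birkhoffSum_sub_const, birkhoffSum_add]
  have h2 := (abs_le.1 (hC (n + 1) u z fun i hi => (hz0 i (by omega)).symm)).2
  have h3 : |birkhoffSum shift f K (shift^[n + 1] z)| ≤ K * B := by
    refine abs_birkhoffSum_le fun j hj => hB _ ?_
    rw [← Function.iterate_add_apply, shift_iterate_apply]
    exact hzF _ (by omega) (by omega)
  have h4 := (abs_le.1 h3).1
  have h5 : (K : ℝ) * maxIntegral f ≤ K * |maxIntegral f| := by
    gcongr; exact le_abs_self _
  push_cast at hu ⊢
  linarith

/-- The numbers `c` such that, for infinitely many `n`, some `n`-th preimage `z` of `y` satisfies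
`c ≤ S_n g z`. The supremum of this set is `limsup_n sup {S_n g z : σ^n z = y}`. -/
def preimageWeights (g : Shift A → ℝ) (y : Shift A) : Set ℝ :=
  {c | ∃ᶠ n in atTop, ∃ z, shift^[n] z = y ∧ c ≤ birkhoffSum shift g n z}

theorem preimageWeights_mono {g : Shift A → ℝ} {y : Shift A} {c d : ℝ}
    (hd : d ∈ preimageWeights g y) (h : c ≤ d) : c ∈ preimageWeights g y :=
  Frequently.mono hd fun _ ⟨z, hz, hdz⟩ => ⟨z, hz, h.trans hdz⟩

theorem mem_preimageWeights_iff_succ {g : Shift A → ℝ} {y : Shift A} {c : ℝ} :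
    c ∈ preimageWeights g y ↔
      ∃ᶠ n in atTop, ∃ z, shift^[n + 1] z = y ∧ c ≤ birkhoffSum shift g (n + 1) z := by
  rw [preimageWeights, Set.mem_ofPred_eq, ← map_add_atTop_eq_nat 1, frequently_map,
    map_add_atTop_eq_nat]

theorem add_mem_preimageWeights {g : Shift A → ℝ} {x : Shift A} {c : ℝ}
    (hc : c ∈ preimageWeights g x) : c + g x ∈ preimageWeights g (shift x) := by
  refine mem_preimageWeights_iff_succ.2 (Frequently.mono hc ?_)
  rintro n ⟨z, rfl, hz⟩
  refine ⟨z, Function.iterate_succ_apply' _ _ _, ?_⟩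
  rw [birkhoffSum_succ]
  linarith

/-- If the sums `S_n g` are bounded above, bounded below on suitable `n`-th preimages of every point,
and have small distortion, then `V y = limsup_n sup {S_n g z : σ^n z = y}` is a bounded continuous
fixed point of the Lax–Oleinik operator `V ↦ max {g x + V x : σ x = y}`. The maximum is attained,
since only finitely many first symbols matter. -/
theorem exists_lax_oleinik_fixedPoint {g : Shift A → ℝ} {D E : ℝ} {n₀ : ℕ}
    (hD : ∀ n z, birkhoffSum shift g n z ≤ D)
    (hE : ∀ y, ∀ n > n₀, ∃ z, shift^[n] z = y ∧ E ≤ birkhoffSum shift g n z)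
    (hδ : ∀ δ > 0, ∃ k : ℕ, ∀ (n : ℕ) (x y : Shift A), (∀ i < n + k, x.1 i = y.1 i) →
      |birkhoffSum shift g n x - birkhoffSum shift g n y| ≤ δ)
    (hfin : ∀ c : ℝ, {i | ∃ x : Shift A, x.1 0 = i ∧ c ≤ g x}.Finite) :
    ∃ V : Shift A → ℝ, Continuous V ∧ (∃ C, ∀ x, |V x| ≤ C) ∧
      (∀ x, g x + V x ≤ V (shift x)) ∧ ∀ y, ∃ x, shift x = y ∧ V y ≤ g x + V x := by
  have hmem : ∀ y, E ∈ preimageWeights g y := fun y =>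
    ((eventually_gt_atTop n₀).mono fun n hn => hE y n hn).frequently
  have hub : ∀ y, D ∈ upperBounds (preimageWeights g y) := fun y c hc => by
    obtain ⟨n, z, -, hz⟩ := hc.exists
    exact hz.trans (hD n z)
  have hbdd : ∀ y, BddAbove (preimageWeights g y) := fun y => ⟨D, hub y⟩
  set V : Shift A → ℝ := fun y => sSup (preimageWeights g y)
  have hEV : ∀ y, E ≤ V y := fun y => le_csSup (hbdd y) (hmem y)
  have hVD : ∀ y, V y ≤ D := fun y => csSup_le ⟨E, hmem y⟩ (hub y)
  refine ⟨V, ?_, ⟨max |E| |D|, fun x => ?_⟩, fun x => ?_, fun y => ?_⟩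
  · have hle : ∀ δ > 0, ∃ k : ℕ, ∀ x y : Shift A, (∀ i < k + 1, x.1 i = y.1 i) → V x - δ ≤ V y := by
      intro δ hδ0
      obtain ⟨k, hk⟩ := hδ δ hδ0
      refine ⟨k, fun x y hxy => ?_⟩
      rw [sub_le_iff_le_add]
      refine csSup_le ⟨E, hmem x⟩ fun c hc => ?_
      rw [← sub_le_iff_le_add]
      refine le_csSup (hbdd y) (Frequently.mono hc ?_)
      rintro n ⟨z, rfl, hz⟩
      have e : z.1 n = y.1 0 := by
        rw [← hxy 0 (by omega), shift_iterate_apply, zero_add]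
      obtain ⟨z', hz', hs⟩ := exists_glue z y n e
      refine ⟨z', hs, ?_⟩
      have h := hk n z z' fun i hi => ?_
      · linarith [(abs_le.1 h).2]
      · rcases Nat.lt_or_ge i n with h | h
        · exact (hz' i h).symm
        · have e1 := shift_iterate_apply z n (i - n)
          have e2 := shift_iterate_apply z' n (i - n)
          rw [Nat.sub_add_cancel h] at e1 e2
          rw [← e1, ← e2, hs, hxy _ (by omega)]
    refine continuous_iff_continuousAt.2 fun x => Metric.tendsto_nhds.2 fun ε hε => ?_
    obtain ⟨k, hk⟩ := hle (ε / 2) (half_pos hε)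
    filter_upwards [(hasBasis_nhds x).mem_of_mem (i := k + 1) trivial] with z hz
    have h1 := hk x z hz
    have h2 := hk z x fun i hi => (hz i hi).symm
    rw [Real.dist_eq, abs_lt]
    constructor <;> linarith
  · exact abs_le_max_abs_abs (hEV x) (hVD x)
  · rw [← le_sub_iff_add_le']
    refine csSup_le ⟨E, hmem x⟩ fun c hc => ?_
    rw [le_sub_iff_add_le]
    exact le_csSup (hbdd _) (add_mem_preimageWeights hc)
  · set T : Set (Shift A) := {x | shift x = y ∧ V y - 1 - D ≤ g x}
    have hTfin : T.Finite := by
      refine Set.Finite.of_finite_image (f := fun x : Shift A => x.1 0)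
        ((hfin (V y - 1 - D)).subset ?_) ?_
      · rintro _ ⟨x, hx, rfl⟩
        exact ⟨x, rfl, hx.2⟩
      · intro x hx x' hx' h
        refine Subtype.ext (funext fun i => ?_)
        cases i with
        | zero => exact h
        | succ i => exact congrFun (congrArg Subtype.val (hx.1.trans hx'.1.symm)) i
    -- Almost optimal preimages of high order pass through `T`, which is finite.
    have hstep : ∀ c, V y - 1 ≤ c → c < V y → ∃ x ∈ T, c ≤ g x + V x := by
      intro c hc1 hc2
      obtain ⟨d, hd, hcd⟩ := exists_lt_of_lt_csSup ⟨E, hmem y⟩ hc2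
      have hc := mem_preimageWeights_iff_succ.1 (preimageWeights_mono hd hcd.le)
      have hfreq : ∃ᶠ n in atTop, ∃ x ∈ T, ∃ z, shift^[n] z = x ∧
          c - g x ≤ birkhoffSum shift g n z := by
        refine hc.mono ?_
        rintro n ⟨z, hz, hcz⟩
        rw [birkhoffSum_succ] at hcz
        refine ⟨shift^[n] z, ⟨?_, ?_⟩, z, rfl, by linarith⟩
        · rw [← hz, Function.iterate_succ_apply']
        · linarith [hD n z]
      obtain ⟨x, hxT, hx⟩ : ∃ x ∈ T, c - g x ∈ preimageWeights g x := by
        by_contra! hcon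
        refine hfreq ?_
        have := (eventually_all_finite hTfin).2 fun x hx => not_frequently.1 (hcon x hx)
        filter_upwards [this] with n hn
        rintro ⟨x, hx, hz⟩
        exact hn x hx hz
      exact ⟨x, hxT, by linarith [le_csSup (hbdd x) hx]⟩
    obtain ⟨x₁, hx₁, -⟩ := hstep (V y - 1) le_rfl (by linarith)
    obtain ⟨x, hxT, hmax⟩ := Set.exists_max_image T (fun x => g x + V x) hTfin ⟨x₁, hx₁⟩
    refine ⟨x, hxT.1, le_of_forall_lt fun c hc => ?_⟩
    obtain ⟨d, hd1, hd2⟩ := exists_between (max_lt hc (sub_one_lt (V y)))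
    obtain ⟨x', hx', hdx⟩ := hstep d ((le_max_right _ _).trans hd1.le) hd2
    exact ((le_max_left _ _).trans_lt hd1).trans_le (hdx.trans (hmax x' hx'))

end Subaction

/-! ### The Aubry set -/

section Aubry

variable {A : ℕ → ℕ → Prop} {f V : Shift A → ℝ}

/-- The function `R = -(f + V - V ∘ σ - m(f))`, the non-negative defect of a sub-action `V`. -/
noncomputable def defect (f V : Shift A → ℝ) (x : Shift A) : ℝ :=
  -(f x + V x - V (shift x) - maxIntegral f)

theorem birkhoffSum_eq_sub_defect (f V : Shift A → ℝ) (n : ℕ) (x : Shift A) :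
    birkhoffSum shift (fun u => f u - maxIntegral f) n x =
      V (shift^[n] x) - V x - birkhoffSum shift (defect f V) n x := by
  induction n with
  | zero => simp
  | succ n ih =>
    rw [birkhoffSum_succ, birkhoffSum_succ, ih, defect, Function.iterate_succ_apply']
    ring

namespace IsBoundedCalibratedSubaction

theorem defect_nonneg (hV : IsBoundedCalibratedSubaction f V) (x : Shift A) : 0 ≤ defect f V x :=
  neg_nonneg.2 (hV.subaction x)

theorem continuous_defect (hV : IsBoundedCalibratedSubaction f V) (hf : Continuous f) :
    Continuous (defect f V) :=
  (((hf.add hV.continuous).sub (hV.continuous.comp continuous_shift)).sub continuous_const).neg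

theorem birkhoffSum_defect_nonneg (hV : IsBoundedCalibratedSubaction f V) (n : ℕ) (x : Shift A) :
    0 ≤ birkhoffSum shift (defect f V) n x :=
  Finset.sum_nonneg fun _ _ => hV.defect_nonneg _

theorem deviation_eq_zero_iff (hV : IsBoundedCalibratedSubaction f V) {x : Shift A} :
    deviation f V x = 0 ↔ ∀ j, defect f V (shift^[j] x) = 0 := by
  rw [deviation, ENNReal.tsum_eq_zero]
  refine forall_congr' fun j => ?_
  rw [ENNReal.ofReal_eq_zero]
  exact ⟨fun h => le_antisymm h (hV.defect_nonneg _), fun h => h.le⟩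

/-- Points of the Aubry set are those with almost closed orbits of almost zero weight. The existence
of a sub-action makes the Mañé potential non-positive on the diagonal. -/
theorem mem_aubrySet_iff (hV : IsBoundedCalibratedSubaction f V) {r : ℝ} (hr0 : 0 < r) (hr1 : r < 1)
    {x : Shift A} : x ∈ aubrySet r f ↔ ∀ (l : ℕ), ∀ δ > 0, ∃ n ≥ 1, ∃ z : Shift A,
      (∀ i < l, x.1 i = z.1 i) ∧ shift^[n] z = x ∧
        -δ ≤ birkhoffSum shift (fun u => f u - maxIntegral f) n z := by
  constructor
  · intro hx l δ hδ
    have h1 : (0 : EReal) ≤ manePre r f x x (r ^ l) :=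
      (show manePotential r f x x = 0 from hx).symm.le.trans (iInf₂_le _ (pow_pos hr0 l))
    have h2 : ((-δ : ℝ) : EReal) < manePre r f x x (r ^ l) :=
      lt_of_lt_of_le (by exact_mod_cast neg_neg_of_pos hδ) h1
    simp only [manePre, lt_iSup_iff, EReal.coe_lt_coe_iff] at h2
    obtain ⟨n, hn, z, ⟨hz, hzx⟩, hs⟩ := h2
    exact ⟨n, hn, z, fun i hi => eq_of_shiftDist_lt hr0 hr1 hz hi, hzx, hs.le⟩
  · intro h
    refine le_antisymm (le_of_forall_gt fun c hc => ?_)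
      (le_iInf₂ fun ε hε => le_of_forall_lt fun c hc => ?_)
    · obtain ⟨δ, hδ, hδc⟩ := EReal.lt_iff_exists_real_btwn.1 hc
      have hδ0 : 0 < δ := by exact_mod_cast hδ
      have hW : {z | dist (V z) (V x) < δ} ∈ 𝓝 x :=
        Metric.tendsto_nhds.1 hV.continuous.continuousAt δ hδ0
      obtain ⟨l, -, hl⟩ := (hasBasis_nhds x).mem_iff.1 hW
      refine lt_of_le_of_lt (iInf₂_le (r ^ l) (pow_pos hr0 l)) (lt_of_le_of_lt ?_ hδc)
      refine iSup₂_le fun n _ => iSup₂_le fun z hz => EReal.coe_le_coe_iff.2 ?_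
      have h1 := hl fun i hi => eq_of_shiftDist_lt hr0 hr1 hz.1 hi
      rw [Set.mem_ofPred_eq, Real.dist_eq, abs_lt] at h1
      rw [birkhoffSum_eq_sub_defect f V, hz.2]
      linarith [hV.birkhoffSum_defect_nonneg n z]
    · obtain ⟨d, hcd, hd⟩ := EReal.lt_iff_exists_real_btwn.1 hc
      have hd0 : d < 0 := by exact_mod_cast hd
      obtain ⟨l, hl⟩ := exists_shiftDist_lt (A := A) hr0 hr1 hε
      obtain ⟨n, hn, z, hz, hzx, hs⟩ := h l (-d) (neg_pos.2 hd0)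
      refine hcd.trans_le (le_iSup₂_of_le n hn (le_iSup₂_of_le z ⟨hl x z hz, hzx⟩ ?_))
      rw [neg_neg] at hs
      exact EReal.coe_le_coe_iff.2 hs

/-- The defect vanishes along the orbits of the Aubry set: it vanishes at each point with almost
closed orbits of almost zero total defect, and the shift preserves the set of these points. -/
theorem defect_eq_zero_of_mem_aubrySet (hV : IsBoundedCalibratedSubaction f V) (hf : Continuous f)
    {r : ℝ} (hr0 : 0 < r) (hr1 : r < 1) {x : Shift A} (hx : x ∈ aubrySet r f) (j : ℕ) :
    defect f V (shift^[j] x) = 0 := by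
  set P : Shift A → Prop := fun x => ∀ (l : ℕ), ∀ δ > 0, ∃ n ≥ 1, ∃ z : Shift A,
    (∀ i < l, x.1 i = z.1 i) ∧ shift^[n] z = x ∧ birkhoffSum shift (defect f V) n z ≤ δ
  have hxP : P x := by
    intro l δ hδ
    have hW : {z | dist (V z) (V x) < δ / 2} ∈ 𝓝 x :=
      Metric.tendsto_nhds.1 hV.continuous.continuousAt _ (half_pos hδ)
    obtain ⟨k, -, hk⟩ := (hasBasis_nhds x).mem_iff.1 hW
    obtain ⟨n, hn, z, hz, hzx, hs⟩ :=
      (hV.mem_aubrySet_iff hr0 hr1).1 hx (max l k) (δ / 2) (half_pos hδ)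
    refine ⟨n, hn, z, fun i hi => hz i (hi.trans_le (le_max_left _ _)), hzx, ?_⟩
    have h1 := hk fun i hi => hz i (hi.trans_le (le_max_right _ _))
    rw [Set.mem_ofPred_eq, Real.dist_eq, abs_lt] at h1
    rw [birkhoffSum_eq_sub_defect f V, hzx] at hs
    linarith
  -- The first term of a sum of non-negative defects is at most the sum.
  have hzero : ∀ x, P x → defect f V x = 0 := by
    intro x hx
    refine le_antisymm (le_of_forall_pos_le_add fun ε hε => ?_) (hV.defect_nonneg x)
    have hW : {z | dist (defect f V z) (defect f V x) < ε / 2} ∈ 𝓝 x :=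
      Metric.tendsto_nhds.1 (hV.continuous_defect hf).continuousAt _ (half_pos hε)
    obtain ⟨l, -, hl⟩ := (hasBasis_nhds x).mem_iff.1 hW
    obtain ⟨n, hn, z, hz, -, hs⟩ := hx l (ε / 2) (half_pos hε)
    have h1 := hl hz
    rw [Set.mem_ofPred_eq, Real.dist_eq, abs_lt] at h1
    obtain ⟨n, rfl⟩ : ∃ k, n = k + 1 := ⟨n - 1, by omega⟩
    rw [birkhoffSum_succ'] at hs
    linarith [hV.birkhoffSum_defect_nonneg n (shift z)]
  -- Shifting `z` replaces its first defect by that of `x`, which is zero.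
  have hshift : ∀ x, P x → P (shift x) := by
    intro x hx l δ hδ
    obtain ⟨n, hn, z, hz, hzx, hs⟩ := hx (l + 1) δ hδ
    refine ⟨n, hn, shift z, fun i hi => hz (i + 1) (by omega), ?_, ?_⟩
    · rw [← Function.iterate_succ_apply, Function.iterate_succ_apply', hzx]
    · have h := birkhoffSum_apply_sub_birkhoffSum shift (defect f V) n z
      rw [hzx, hzero x hx] at h
      linarith [hV.defect_nonneg z]
  have hj : P (shift^[j] x) := by
    induction j with
    | zero => exact hxP
    | succ j ih =>
      rw [Function.iterate_succ_apply']
      exact hshift _ ih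
  exact hzero _ hj

/-- Invariant probabilities on which the defect vanishes are maximizing. -/
theorem isMaximizing (hV : IsBoundedCalibratedSubaction f V)
    (hm : ((maxIntegral f : ℝ) : EReal) = supIntegral f) {ν : Measure (Shift A)}
    (hν : ν ∈ invariantMeasures A) (h0 : ∀ᵐ x ∂ν, defect f V x = 0) : IsMaximizing f ν := by
  refine ⟨hν, ?_⟩
  have := hν.1
  obtain ⟨C, hC⟩ := hV.bounded
  have hVi : Integrable V ν :=
    Integrable.of_bound hV.continuous.aestronglyMeasurable C (Eventually.of_forall hC)
  have hVs : Integrable (fun x => V (shift x)) ν :=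
    (hν.2.integrable_comp hVi.aestronglyMeasurable).2 hVi
  have hVe : ∫ x, V (shift x) ∂ν = ∫ x, V x ∂ν := by
    conv_rhs => rw [← hν.2.map_eq]
    rw [integral_map hν.2.measurable.aemeasurable hV.continuous.aestronglyMeasurable]
  have hfe : f =ᵐ[ν] fun x => V (shift x) - V x + maxIntegral f := by
    filter_upwards [h0] with x hx
    rw [defect] at hx
    linarith
  have hd : Integrable (fun x => V (shift x) - V x) ν := hVs.sub hVi
  have hi : Integrable (fun x => V (shift x) - V x + maxIntegral f) ν :=
    hd.add (integrable_const _)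
  rw [extIntegral_eq_integral (hi.congr hfe.symm), ← hm, integral_congr_ae hfe,
    integral_add hd (integrable_const _), integral_sub hVs hVi, hVe]
  simp

/-- The points along whose orbits the defect vanishes form a compact set: on them `f` is at least
`m(f) - 2 sup |V|`, which leaves finitely many symbols. -/
theorem isCompact_setOf_defect_eq_zero (hV : IsBoundedCalibratedSubaction f V) (hf : Continuous f)
    (hfin : ∀ c : ℝ, {i | ∃ x : Shift A, x.1 0 = i ∧ c ≤ f x}.Finite) :
    IsCompact {x | ∀ j, defect f V (shift^[j] x) = 0} := by
  obtain ⟨C, hC⟩ := hV.bounded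
  refine (isCompact_setOf_forall_mem (hfin (maxIntegral f - 2 * C)).toFinset).of_isClosed_subset
    ?_ ?_
  · rw [Set.ofPred_forall]
    exact isClosed_iInter fun j => isClosed_eq
      ((hV.continuous_defect hf).comp (continuous_shift.iterate j)) continuous_const
  · intro x hx j
    rw [Set.Finite.mem_toFinset]
    refine ⟨shift^[j] x, by rw [shift_iterate_apply, zero_add], ?_⟩
    have h := hx j
    rw [defect] at h
    have h1 := abs_le.1 (hC (shift^[j] x))
    have h2 := abs_le.1 (hC (shift (shift^[j] x)))
    linarith

/-- If the maximizing measure is unique, any two non-empty compact invariant sets on which the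
defect vanishes intersect, since each of them carries a maximizing measure. -/
theorem inter_nonempty (hV : IsBoundedCalibratedSubaction f V)
    (hm : ((maxIntegral f : ℝ) : EReal) = supIntegral f)
    (huniq : ∀ μ ν, IsMaximizing f μ → IsMaximizing f ν → μ = ν) {E E' : Set (Shift A)}
    (hE : IsCompact E) (hE' : IsCompact E') (hne : E.Nonempty) (hne' : E'.Nonempty)
    (hs : Set.MapsTo shift E E) (hs' : Set.MapsTo shift E' E')
    (h0 : ∀ x ∈ E, defect f V x = 0) (h0' : ∀ x ∈ E', defect f V x = 0) : (E ∩ E').Nonempty := by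
  have : TopologicalSpace.PseudoMetrizableSpace (Shift A) :=
    IsInducing.subtypeVal.pseudoMetrizableSpace
  obtain ⟨μ, hμ, hμs, hμE⟩ := exists_invariant_probability_of_isCompact continuous_shift hE hne hs
  obtain ⟨ν, hν, hνs, hνE⟩ :=
    exists_invariant_probability_of_isCompact continuous_shift hE' hne' hs'
  obtain rfl := huniq μ ν (hV.isMaximizing hm ⟨hμ, hμs⟩ (hμE.mono h0))
    (hV.isMaximizing hm ⟨hν, hνs⟩ (hνE.mono h0'))
  exact (hμE.and hνE).exists

/-- A point along whose orbit the defect vanishes belongs to the Aubry set if the maximizing measure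
is unique. By calibration the point has a backward orbit of zero defect. The limit sets of the
forward and of the backward orbit share a point, and near that point one passes from the forward to
the backward orbit. -/
theorem mem_aubrySet_of_defect_eq_zero (hV : IsBoundedCalibratedSubaction f V) (hf : Walters f)
    (hm : ((maxIntegral f : ℝ) : EReal) = supIntegral f)
    (hfin : ∀ c : ℝ, {i | ∃ x : Shift A, x.1 0 = i ∧ c ≤ f x}.Finite)
    (huniq : ∀ μ ν, IsMaximizing f μ → IsMaximizing f ν → μ = ν)
    {r : ℝ} (hr0 : 0 < r) (hr1 : r < 1) {x : Shift A}
    (hx : ∀ j, defect f V (shift^[j] x) = 0) : x ∈ aubrySet r f := by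
  have hZ := hV.isCompact_setOf_defect_eq_zero hf.continuous hfin
  set Z : Set (Shift A) := {x | ∀ j, defect f V (shift^[j] x) = 0}
  -- `u` is the forward orbit of `x`, and `y` a backward orbit of zero defect.
  choose b hbs hb0 using hV.calibrated
  set y : ℕ → Shift A := fun n => b^[n] x with hy
  set u : ℕ → Shift A := fun n => shift^[n] x with hu
  have hys : ∀ n, shift (y (n + 1)) = y n := fun n => by
    rw [hy]
    simp only [Function.iterate_succ_apply']
    exact hbs _
  have hyx : ∀ n, shift^[n] (y n) = x := fun n => by
    induction n with
    | zero => rfl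
    | succ n ih => rw [Function.iterate_succ_apply, hys, ih]
  have hyZ : ∀ n, y n ∈ Z := fun n => by
    induction n with
    | zero => exact hx
    | succ n ih =>
      intro j
      cases j with
      | zero =>
        rw [hy]
        simp only [Function.iterate_succ_apply', Function.iterate_zero, id_eq]
        rw [defect, hb0, neg_zero]
      | succ j => rw [Function.iterate_succ_apply, hys, ih j]
  have huZ : ∀ n, u n ∈ Z := fun n j => by
    rw [hu]
    simp only [← Function.iterate_add_apply]
    exact hx _
  have hclZ : ∀ v : ℕ → Shift A, (∀ n, v n ∈ Z) → {p | MapClusterPt p atTop v} ⊆ Z := by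
    intro v hv p hp
    by_contra hpZ
    have := MapClusterPt.frequently hp (hZ.isClosed.isOpen_compl.mem_nhds hpZ)
    obtain ⟨n, hn⟩ := this.exists
    exact hn (hv n)
  have hcl : ∀ v : ℕ → Shift A, (∀ n, v n ∈ Z) → IsCompact {p | MapClusterPt p atTop v} ∧
      {p | MapClusterPt p atTop v}.Nonempty := by
    intro v hv
    refine ⟨hZ.of_isClosed_subset (isClosed_setOf_mapClusterPt v) (hclZ v hv), ?_⟩
    obtain ⟨p, -, hp⟩ := hZ.exists_mapClusterPt (f := atTop) (u := v)
      (tendsto_principal.2 (Eventually.of_forall hv))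
    exact ⟨p, hp⟩
  have hsu : Set.MapsTo shift {p | MapClusterPt p atTop u} {p | MapClusterPt p atTop u} := by
    intro p hp
    have h := MapClusterPt.continuousAt_comp continuous_shift.continuousAt hp
    refine mapClusterPt_add_one_iff.1 ?_
    convert h using 1
    funext n
    exact Function.iterate_succ_apply' _ _ _
  have hsy : Set.MapsTo shift {p | MapClusterPt p atTop y} {p | MapClusterPt p atTop y} := by
    intro p hp
    have h := MapClusterPt.continuousAt_comp continuous_shift.continuousAt
      (mapClusterPt_add_one_iff.2 hp)
    have e : shift ∘ (fun n => y (n + 1)) = y := funext hys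
    rwa [e] at h
  obtain ⟨p, hpu, hpy⟩ := hV.inter_nonempty hm huniq (hcl u huZ).1 (hcl y hyZ).1
    (hcl u huZ).2 (hcl y hyZ).2 hsu hsy (fun p hp => hclZ u huZ hp 0) (fun p hp => hclZ y hyZ hp 0)
  refine (hV.mem_aubrySet_iff hr0 hr1).2 fun l δ hδ => ?_
  obtain ⟨k, hk⟩ := hf.exists_abs_sub_le (δ := δ / 3) (by positivity)
  have hW : ∀ᶠ q in 𝓝 p, dist (V q) (V p) < δ / 3 ∧ ∀ i < k + 1, p.1 i = q.1 i :=
    (Metric.tendsto_nhds.1 hV.continuous.continuousAt _ (by positivity)).and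
      ((hasBasis_nhds p).mem_of_mem (i := k + 1) trivial)
  -- `shift^[n] x` and `y q` are both close to `p`; the point `z` follows `x` for `n` steps and
  -- continues as `y q`, so that it returns to `x` after `n + q` steps.
  obtain ⟨n, ⟨hnV, hn⟩, hln⟩ :=
    ((MapClusterPt.frequently hpu hW).and_eventually (eventually_ge_atTop (l + 1))).exists
  obtain ⟨q, hqV, hq⟩ := (MapClusterPt.frequently hpy hW).exists
  have e : x.1 n = (y q).1 0 := by
    rw [← hq 0 (by omega), hn 0 (by omega)]
    simp only [hu, shift_iterate_apply, zero_add]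
  obtain ⟨z, hz, hzs⟩ := exists_glue x (y q) n e
  have hxz : ∀ i < n + k, x.1 i = z.1 i := by
    intro i hi
    rcases Nat.lt_or_ge i n with h | h
    · exact (hz i h).symm
    · have e1 := shift_iterate_apply x n (i - n)
      have e2 := shift_iterate_apply z n (i - n)
      rw [Nat.sub_add_cancel h] at e1 e2
      rw [← e1, ← e2, hzs, ← hq _ (by omega)]
      exact (hn _ (by omega)).symm
  refine ⟨n + q, by omega, z, fun i hi => hxz i (by omega), ?_, ?_⟩
  · rw [add_comm, Function.iterate_add_apply, hzs, hyx]
  · have hsum0 : ∀ (w : Shift A) (j : ℕ), w ∈ Z → birkhoffSum shift (defect f V) j w = 0 :=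
      fun w j hw => Finset.sum_eq_zero fun i _ => hw i
    have h1 := birkhoffSum_eq_sub_defect f V n x
    have h2 := birkhoffSum_eq_sub_defect f V q (y q)
    rw [hsum0 x n hx] at h1
    rw [hsum0 _ q (hyZ q), hyx] at h2
    rw [birkhoffSum_add, hzs, h2]
    have h3 := (abs_le.1 (hk n x z hxz)).2
    rw [birkhoffSum_sub_const] at h1 ⊢
    rw [Real.dist_eq, abs_lt] at hnV hqV
    linarith [hnV.1, hqV.2]

end IsBoundedCalibratedSubaction

end Aubry

end CMS

theorem mainTheorem6 (A : ℕ → ℕ → Prop) (hA : CMS.FinitelyPrimitive A)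
    (r : ℝ) (hr0 : 0 < r) (hr1 : r < 1)
    (f : CMS.Shift A → ℝ) (hf : CMS.Walters f) (hf1 : CMS.variation 1 f < ⊤)
    (a : ℕ) (ha : CMS.Admissible A a) (hP : CMS.gurevichPressure f a < ⊤)
    (hmax : ∃! μ : Measure (CMS.Shift A), CMS.IsMaximizing f μ) :
    (∃ V : CMS.Shift A → ℝ, CMS.IsBoundedCalibratedSubaction f V) ∧
      ∀ V : CMS.Shift A → ℝ, CMS.IsBoundedCalibratedSubaction f V →
        CMS.aubrySet r f = {x : CMS.Shift A | CMS.deviation f V x = 0} := by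
  obtain ⟨K, F, hA⟩ := hA.exists_connecting
  obtain ⟨C, hC⟩ := hf.exists_abs_sub_le_of_variation_one hf1
  have hC1 : ∀ x y : CMS.Shift A, x.1 0 = y.1 0 → |f x - f y| ≤ C := fun x y h => by
    simpa using hC 1 x y (by simpa using h)
  have hfin := CMS.finite_setOf_le_of_gurevichPressure_lt_top hA hC1 ha hP
  obtain ⟨M, hM⟩ := CMS.exists_le_of_finite_setOf_le hC1 hfin
  obtain ⟨x₀, -⟩ := ha
  have hm := CMS.coe_maxIntegral hA x₀ hf.continuous hM
  obtain ⟨μ, hμ, huniq⟩ := hmax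
  refine ⟨?_, fun V hV => ?_⟩
  · obtain ⟨D, hD⟩ := CMS.exists_birkhoffSum_sub_maxIntegral_le hA hf.continuous hm hC
    obtain ⟨E, hE⟩ := CMS.exists_le_birkhoffSum_sub_maxIntegral hA hf.continuous hm hM hμ hC
    have hδ : ∀ δ > 0, ∃ k : ℕ, ∀ (n : ℕ) (x y : CMS.Shift A), (∀ i < n + k, x.1 i = y.1 i) →
        |birkhoffSum CMS.shift (fun u => f u - CMS.maxIntegral f) n x -
          birkhoffSum CMS.shift (fun u => f u - CMS.maxIntegral f) n y| ≤ δ := by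
      simpa only [CMS.birkhoffSum_sub_const, sub_sub_sub_cancel_right] using
        fun δ hδ => hf.exists_abs_sub_le hδ
    have hfin' : ∀ c : ℝ,
        {i | ∃ x : CMS.Shift A, x.1 0 = i ∧ c ≤ f x - CMS.maxIntegral f}.Finite := by
      simpa only [le_sub_iff_add_le] using fun c => hfin (c + CMS.maxIntegral f)
    obtain ⟨V, hVc, hVb, hVs, hVm⟩ := CMS.exists_lax_oleinik_fixedPoint hD hE hδ hfin'
    refine ⟨V, hVc, hVb, fun x => by linarith [hVs x], fun y => ?_⟩
    obtain ⟨x, rfl, hx⟩ := hVm y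
    exact ⟨x, rfl, by linarith [hVs x]⟩
  · refine Set.ext fun x => ?_
    rw [Set.mem_ofPred_eq, hV.deviation_eq_zero_iff]
    exact ⟨hV.defect_eq_zero_of_mem_aubrySet hf.continuous hr0 hr1,
      hV.mem_aubrySet_of_defect_eq_zero hf hm hfin
        (fun ν ν' h h' => (huniq ν h).trans (huniq ν' h').symm) hr0 hr1⟩
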